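/- Let $-1<q<1$ and $[n]_q=\sum_{j=0}^{n-1}q^j$. For $0\le s<t$ and $x\in\mathbb R$ let $Q_n(y|x,s,t)$ be the monic polynomials in $y$ given by $Q_0=1$, $Q_1=y-x$ and $$yQ_n=Q_{n+1}+xq^nQ_n+(t-sq^{n-1})[n]_qQ_{n-1},\qquad n\ge 1 .$$ There is a unique probability measure on $\mathbb R$ with finite moments of all orders for which $(Q_n(\cdot|x,s,t))_{n\ge0}$ are orthogonal; denote it by $P_{s,t}(x,dy)$. These measures are the transition probabilities of the $q$-Wiener process (the $q$-Meixner process with $\theta=\tau=0$). Put $(\mathsf P_{s,t}f)(x)=\int f(y)\,P_{s,t}(x,dy)$. Fix $t>0$. For a twice continuously differentiable $f$, write $\frac{\partial}{\partial x}\frac{f(y)-f(x)}{y-x}$ for the function of $y$ given by this formula for $y\ne x$, and by its continuous extension $\frac12 f''(x)$ at $y=x$. Let $$(\mathbb A_tf)(x)=\int_{\mathbb R}\left(\frac{\partial}{\partial x}\frac{f(y)-f(x)}{y-x}\right)P_{q^2t,\,t}(qx,dy).$$ 1. If $f$ is a polynomial, then for every $x\in\mathbb R$ the integral converges absolutely and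 $$\lim_{h\to0^+}\frac{(\mathsf P_{t-h,t}f)(x)-f(x)}{h}=\lim_{h\to0^+}\frac{(\mathsf P_{t,t+h}f)(x)-f(x)}{h}=(\mathbb A_tf)(x).$$ 2. If $f:\mathbb R\to\mathbb R$ is a bounded continuous function with bounded continuous second derivative, then for every $x\in\mathbb R$ the integral converges absolutely, and $f$ belongs to the domains of both the weak left and the weak right infinitesimal generator at time $t$, which both map $f$ to $\mathbb A_tf$. That is, both limits in 1 hold for every $x\in\mathbb R$, and moreover $$\sup_{0<h\le t}\ \sup_{x\in\mathbb R}\left|\frac{(\mathsf P_{t-h,t}f)(x)-f(x)}{h}\right|<\infty,\qquad \sup_{h>0}\ \sup_{x\in\mathbb R}\left|\frac{(\mathsf P_{t,t+h}f)(x)-f(x)}{h}\right|<\infty .$$ Moreover, for every $x\in\mathbb R$ the measure $P_{q^2t,t}(qx,\cdot)$ equals $\nu_{x,t}$, the orthogonality probability measure of the monic polynomials $W_n(y;x,t)$ given by $W_{-1}=0$, $W_0=1$ and $$yW_n=W_{n+1}+xq^{n+1}W_n+(1-q)t\,[n]_q[n+1]_qW_{n-1},\qquad n\ge0 .$$ 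-/

import Mathlib

open MeasureTheory Filter Topology Polynomial

noncomputable section

namespace QMeixner

/-- The `q`-number `[n]_q = 1 + q + ⋯ + q^(n-1)`. -/
def qNum (q : ℝ) (n : ℕ) : ℝ := ∑ j ∈ Finset.range n, q ^ j

/-- The monic polynomials `Q_n(y | x, s, t)` in the variable `y` of the `q`-Meixner process with
parameters `θ`, `τ`, `q`: `Q_0 = 1`, `Q_1 = y - x`, and for `n ≥ 1`
`y Q_n = Q_{n+1} + (θ [n]_q + x q^n) Q_n + (t - s q^(n-1) + τ [n-1]_q) [n]_q Q_{n-1}`. -/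
def polyQ (θ τ q x s t : ℝ) : ℕ → ℝ[X]
  | 0 => 1
  | 1 => X - C x
  | n + 2 =>
      (X - C (θ * qNum q (n + 1) + x * q ^ (n + 1))) * polyQ θ τ q x s t (n + 1)
        - C ((t - s * q ^ n + τ * qNum q n) * qNum q (n + 1)) * polyQ θ τ q x s t n

/-- The monic polynomials `W_n(y; x, t)` in the variable `y`: `W_{-1} = 0`, `W_0 = 1`, and for
`n ≥ 0`
`y W_n = W_{n+1} + (θ [n+1]_q + x q^(n+1)) W_n + ((1-q) t + τ) [n]_q [n+1]_q W_{n-1}`. -/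
def polyW (θ τ q x t : ℝ) : ℕ → ℝ[X]
  | 0 => 1
  | 1 => X - C (θ * qNum q 1 + x * q ^ 1)
  | n + 2 =>
      (X - C (θ * qNum q (n + 2) + x * q ^ (n + 2))) * polyW θ τ q x t (n + 1)
        - C (((1 - q) * t + τ) * qNum q (n + 1) * qNum q (n + 2)) * polyW θ τ q x t n

/-- `μ` is an orthogonality measure of the sequence `p` of real polynomials: a Borel probability
measure with all moments finite, for which distinct members of the sequence are orthogonal. -/
structure IsOrthogonalityMeasure (p : ℕ → ℝ[X]) (μ : Measure ℝ) : Prop where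
  isProbabilityMeasure : IsProbabilityMeasure μ
  integrable_eval : ∀ r : ℝ[X], Integrable (fun y => r.eval y) μ
  orthogonal : ∀ m n : ℕ, m ≠ n → ∫ y, (p m).eval y * (p n).eval y ∂μ = 0

open Classical in
/-- The orthogonality measure of a sequence of polynomials (`0` if there is none). -/
def orthogonalityMeasure (p : ℕ → ℝ[X]) : Measure ℝ :=
  if h : ∃ μ, IsOrthogonalityMeasure p μ then h.choose else 0

/-- The transition probabilities `P_{s,t}(x, dy)` of the `q`-Meixner process with parameters
`θ`, `τ`, `q` (meaningful for `0 ≤ s < t`). -/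
def transitionMeasure (θ τ q s t x : ℝ) : Measure ℝ :=
  orthogonalityMeasure (polyQ θ τ q x s t)

/-- The measure `ν_{x,t}(dy)`, the orthogonality measure of the polynomials `W_n(y; x, t)`. -/
def nuMeasure (θ τ q x t : ℝ) : Measure ℝ :=
  orthogonalityMeasure (polyW θ τ q x t)

/-- The transition probabilities `P_{s,t}(x, dy)` of the `q`-Wiener process, the `q`-Meixner
process with `θ = τ = 0`. -/
def wienerTransition (q s t x : ℝ) : Measure ℝ := transitionMeasure 0 0 q s t x

/-- The transition operators `f ↦ (x ↦ ∫ f(y) P_{s,t}(x, dy))` of a family of transition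
probabilities `P s t x`. -/
def transitionOp (P : ℝ → ℝ → ℝ → Measure ℝ) (s t : ℝ) (f : ℝ → ℝ) (x : ℝ) : ℝ :=
  ∫ y, f y ∂(P s t x)

/-- The left difference quotient `(P_{t-h,t} f - f) / h` at `x`. -/
def leftQuotient (P : ℝ → ℝ → ℝ → Measure ℝ) (t : ℝ) (f : ℝ → ℝ) (h x : ℝ) : ℝ :=
  (1 / h) * (transitionOp P (t - h) t f x - f x)

/-- The right difference quotient `(P_{t,t+h} f - f) / h` at `x`. -/
def rightQuotient (P : ℝ → ℝ → ℝ → Measure ℝ) (t : ℝ) (f : ℝ → ℝ) (h x : ℝ) : ℝ :=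
  (1 / h) * (transitionOp P t (t + h) f x - f x)

/-- `g` is the pointwise limit of `(P_{t-h,t} f - f) / h` as `h → 0+`. -/
def IsPointwiseLeftGenerator (P : ℝ → ℝ → ℝ → Measure ℝ) (t : ℝ) (f g : ℝ → ℝ) : Prop :=
  ∀ x, Tendsto (fun h => leftQuotient P t f h x) (𝓝[>] 0) (𝓝 (g x))

/-- `g` is the pointwise limit of `(P_{t,t+h} f - f) / h` as `h → 0+`. -/
def IsPointwiseRightGenerator (P : ℝ → ℝ → ℝ → Measure ℝ) (t : ℝ) (f g : ℝ → ℝ) : Prop :=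
  ∀ x, Tendsto (fun h => rightQuotient P t f h x) (𝓝[>] 0) (𝓝 (g x))

/-- `f` is in the domain of the weak left infinitesimal generator at time `t`, and the generator
maps it to `g`: `f` is bounded and continuous, the left difference quotients converge to `g`
pointwise, and their supremum norms are bounded. The times range over `[0, ∞)`, so `h ≤ t`. -/
structure IsWeakLeftGenerator (P : ℝ → ℝ → ℝ → Measure ℝ) (t : ℝ) (f g : ℝ → ℝ) : Prop where
  continuous : Continuous f
  bounded : ∃ K, ∀ x, |f x| ≤ K
  pointwise : IsPointwiseLeftGenerator P t f g
  bounded_quotient : ∃ K, ∀ h, 0 < h → h ≤ t → ∀ x, |leftQuotient P t f h x| ≤ K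

/-- `f` is in the domain of the weak right infinitesimal generator at time `t`, and the generator
maps it to `g`: `f` is bounded and continuous, the right difference quotients converge to `g`
pointwise, and their supremum norms are bounded. -/
structure IsWeakRightGenerator (P : ℝ → ℝ → ℝ → Measure ℝ) (t : ℝ) (f g : ℝ → ℝ) : Prop where
  continuous : Continuous f
  bounded : ∃ K, ∀ x, |f x| ≤ K
  pointwise : IsPointwiseRightGenerator P t f g
  bounded_quotient : ∃ K, ∀ h, 0 < h → ∀ x, |rightQuotient P t f h x| ≤ K

open Classical in
/-- The integrand `∂/∂x ((f(y) - f(x)) / (y - x))` as a function of `y`, with its value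
`f''(x) / 2` at `y = x` (the continuous extension when `f` is twice continuously
differentiable). -/
def derivDividedDifference (f : ℝ → ℝ) (x y : ℝ) : ℝ :=
  if y = x then deriv (deriv f) x / 2 else deriv (fun u => (f y - f u) / (y - u)) x

/-- `x ↦ ∫ ∂/∂x ((f(y) - f(x)) / (y - x)) P_{q²t,t}(qx, dy)`. -/
def wienerGenerator (q t : ℝ) (f : ℝ → ℝ) (x : ℝ) : ℝ :=
  ∫ y, derivDividedDifference f x y ∂(wienerTransition q (q ^ 2 * t) t (q * x))

end QMeixner

end

/-! The measure `P_{s,t}(x,·)` belongs to a three-term recurrence with bounded coefficients `a_n = x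
q^n` and `b_n = (t - s q^n)[n+1]_q`, so it has mean `a_0 = x` and variance `b_0 = t - s`. In the
second-order Taylor formula at `x` the linear term integrates to zero, hence the difference quotient
over `[s,t]` is exactly the integral of `derivDividedDifference f x` against the probability measure
with density `(y-x)²/(t-s)` (`quotient_eq_integral`). A bound on `f''` therefore bounds all
quotients at once.

The moments of this tilted measure are the entries `(J^k e_1)_1` for the Jacobi operator `J`. As `s`
and `t` merge, `b_0 → 0` and index 0 decouples from the higher ones, so the moments tend to those of
the recurrence with coefficients `a_{n+1}`, `b_{n+1}` taken at `s = t`. That shifted recurrence is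
the one for `P_{q²t,t}(qx,·)`, and also the one for `W_n`. Bounded coefficients give a common
compact support, so Weierstrass approximation upgrades moment convergence to all continuous
integrands (`tendsto_integral_squareTilt`). The same estimate gives uniqueness; existence comes from
Gauss quadrature and weak compactness. -/

noncomputable section

namespace QMeixner

/-! ### Three-term recurrences and moments -/

/-- The monic polynomials of the three-term recurrence
`y p_n = p_{n+1} + a_n p_n + b_{n-1} p_{n-1}`. -/
def favardPoly (a b : ℕ → ℝ) : ℕ → ℝ[X]
  | 0 => 1
  | 1 => X - C (a 0)
  | n + 2 => (X - C (a (n + 1))) * favardPoly a b (n + 1) - C (b n) * favardPoly a b n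

/-- The tridiagonal operator of the three-term recurrence, acting on sequences. -/
def jacobiStep (a b u : ℕ → ℝ) : ℕ → ℝ
  | 0 => u 1 + a 0 * u 0
  | n + 1 => u (n + 2) + a (n + 1) * u (n + 1) + b n * u n

/-- The sup-norm operator norm of `jacobiStep a b` is at most `1 + A + B`; this number later bounds
the supports. -/
theorem abs_jacobiStep_iterate_le {a b u : ℕ → ℝ} {A B : ℝ} (ha : ∀ n, |a n| ≤ A)
    (hb : ∀ n, |b n| ≤ B) (hu : ∀ n, |u n| ≤ 1) (k n : ℕ) :
    |(jacobiStep a b)^[k] u n| ≤ (1 + A + B) ^ k := by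
  have hA : 0 ≤ A := (abs_nonneg _).trans (ha 0)
  have hB : 0 ≤ B := (abs_nonneg _).trans (hb 0)
  induction k generalizing n with
  | zero => simpa using hu n
  | succ k ih =>
    rw [Function.iterate_succ_apply']
    set v := (jacobiStep a b)^[k] u
    have h0 : 0 ≤ (1 + A + B) ^ k := by positivity
    have h1 : ∀ i j, |a i * v j| ≤ A * (1 + A + B) ^ k := fun i j => by
      rw [abs_mul]; exact mul_le_mul (ha i) (ih j) (abs_nonneg _) hA
    have h2 : ∀ i j, |b i * v j| ≤ B * (1 + A + B) ^ k := fun i j => by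
      rw [abs_mul]; exact mul_le_mul (hb i) (ih j) (abs_nonneg _) hB
    rw [pow_succ']
    cases n with
    | zero =>
      calc |v 1 + a 0 * v 0| ≤ |v 1| + |a 0 * v 0| := abs_add_le _ _
        _ ≤ _ := by nlinarith [ih 1, h1 0 0, mul_nonneg hB h0]
    | succ n =>
      calc |v (n + 2) + a (n + 1) * v (n + 1) + b n * v n|
          ≤ |v (n + 2)| + |a (n + 1) * v (n + 1)| + |b n * v n| := abs_add_three _ _ _
        _ ≤ _ := by nlinarith [ih (n + 2), h1 (n + 1) (n + 1), h2 n n]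

theorem tendsto_jacobiStep_iterate {ι : Type*} {l : Filter ι} {a b : ι → ℕ → ℝ}
    {a' b' : ℕ → ℝ} (ha : ∀ n, Tendsto (fun i => a i n) l (𝓝 (a' n)))
    (hb : ∀ n, Tendsto (fun i => b i n) l (𝓝 (b' n))) (u : ℕ → ℝ) (k n : ℕ) :
    Tendsto (fun i => (jacobiStep (a i) (b i))^[k] u n) l
      (𝓝 ((jacobiStep a' b')^[k] u n)) := by
  induction k generalizing n with
  | zero => exact tendsto_const_nhds
  | succ k ih =>
    simp only [Function.iterate_succ_apply']
    cases n with
    | zero => exact (ih 1).add ((ha 0).mul (ih 0))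
    | succ n => exact ((ih (n + 2)).add ((ha _).mul (ih _))).add ((hb _).mul (ih _))

/-- Index 1 sees index 0 only through `b 0`, so when `b 0 = 0` the tail of the sequence evolves by
itself. -/
theorem jacobiStep_iterate_shift {a b : ℕ → ℝ} (hb : b 0 = 0) (u : ℕ → ℝ) (k n : ℕ) :
    (jacobiStep a b)^[k] u (n + 1)
      = (jacobiStep (fun n => a (n + 1)) (fun n => b (n + 1)))^[k] (fun n => u (n + 1)) n := by
  induction k generalizing n with
  | zero => rfl
  | succ k ih =>
    simp only [Function.iterate_succ_apply']
    cases n with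
    | zero => simp [jacobiStep, ih, hb]
    | succ n => simp [jacobiStep, ih]

theorem eval_mul_favardPoly (a b : ℕ → ℝ) (n : ℕ) (y : ℝ) :
    y * (favardPoly a b n).eval y = jacobiStep a b (fun n => (favardPoly a b n).eval y) n := by
  cases n with
  | zero => simp [favardPoly, jacobiStep]
  | succ n =>
    simp only [favardPoly, jacobiStep, eval_sub, eval_mul, eval_X, eval_C]
    ring

theorem jacobiStep_integral {a b : ℕ → ℝ} {μ : Measure ℝ} {F : ℕ → ℝ → ℝ}
    (hF : ∀ n, Integrable (F n) μ) (n : ℕ) :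
    ∫ y, jacobiStep a b (fun n => F n y) n ∂μ = jacobiStep a b (fun n => ∫ y, F n y ∂μ) n := by
  cases n with
  | zero =>
    simp only [jacobiStep]
    rw [integral_add (hF _) ((hF _).const_mul _), integral_const_mul]
  | succ n =>
    simp only [jacobiStep]
    refine (integral_add ((hF _).add ((hF _).const_mul _)) ((hF _).const_mul _)).trans ?_
    refine congr_arg₂ _ ((integral_add (hF _) ((hF _).const_mul _)).trans ?_)
      (integral_const_mul _ _)
    rw [integral_const_mul]

/-- Multiplication by `y` acts on `n ↦ p_n(y)` as `jacobiStep`, and this passes through the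
integral. Taking `r = 1` gives the moments of `μ`; taking `r = p_1 / b_0` gives those of
`squareTilt`. -/
theorem integral_pow_mul_favardPoly {a b : ℕ → ℝ} {μ : Measure ℝ}
    (hμ : ∀ r : ℝ[X], Integrable (fun y => r.eval y) μ) (r : ℝ[X]) (k n : ℕ) :
    ∫ y, y ^ k * r.eval y * (favardPoly a b n).eval y ∂μ
      = (jacobiStep a b)^[k] (fun n => ∫ y, r.eval y * (favardPoly a b n).eval y ∂μ) n := by
  induction k generalizing n with
  | zero => simp
  | succ k ih =>
    rw [Function.iterate_succ_apply']
    simp_rw [← funext ih]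
    rw [← jacobiStep_integral]
    · congr 1 with y
      rw [show y ^ (k + 1) * r.eval y * (favardPoly a b n).eval y
        = y ^ k * r.eval y * (y * (favardPoly a b n).eval y) by ring, eval_mul_favardPoly]
      cases n <;> simp only [jacobiStep] <;> ring
    · intro n
      exact (hμ (X ^ k * r * favardPoly a b n)).congr (ae_of_all _ fun y => by simp)

theorem IsOrthogonalityMeasure.integral_favardPoly {a b : ℕ → ℝ} {μ : Measure ℝ}
    (hμ : IsOrthogonalityMeasure (favardPoly a b) μ) :
    (fun n => ∫ y, (1 : ℝ[X]).eval y * (favardPoly a b n).eval y ∂μ) = Pi.single 0 1 := by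
  have := hμ.isProbabilityMeasure
  ext n
  rcases Nat.eq_zero_or_pos n with rfl | hn
  · simp [favardPoly]
  · rw [Pi.single_eq_of_ne hn.ne']
    exact hμ.orthogonal 0 n hn.ne

theorem IsOrthogonalityMeasure.integral_pow {a b : ℕ → ℝ} {μ : Measure ℝ}
    (hμ : IsOrthogonalityMeasure (favardPoly a b) μ) (k : ℕ) :
    ∫ y, y ^ k ∂μ = (jacobiStep a b)^[k] (Pi.single 0 1) 0 := by
  rw [← hμ.integral_favardPoly, ← integral_pow_mul_favardPoly hμ.integrable_eval]
  simp [favardPoly]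

theorem IsOrthogonalityMeasure.integral_favardPoly_one {a b : ℕ → ℝ} {μ : Measure ℝ}
    (hμ : IsOrthogonalityMeasure (favardPoly a b) μ) :
    (fun n => ∫ y, (favardPoly a b 1).eval y * (favardPoly a b n).eval y ∂μ)
      = Pi.single 1 (b 0) := by
  have := hμ.isProbabilityMeasure
  ext n
  rcases eq_or_ne n 1 with rfl | hn
  · have h1 := integral_pow_mul_favardPoly (a := a) (b := b) hμ.integrable_eval 1 1 1
    rw [hμ.integral_favardPoly] at h1
    have h2 := hμ.orthogonal 0 1 zero_ne_one
    simp only [Function.iterate_one, jacobiStep, Pi.single_apply] at h1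
    simp only [favardPoly, eval_one, one_mul, eval_sub, eval_X, eval_C] at h1 h2 ⊢
    simp only [Pi.single_eq_same]
    -- Since `∫ p_1 = 0`, replacing one factor `y - a 0` by `y` does not change the integral, and `∫
    -- y p_1` is one application of `jacobiStep` to `e_0`.
    have h3 : (fun y : ℝ => (y - a 0) * (y - a 0))
        = fun y => y ^ 1 * 1 * (y - a 0) - a 0 * (y - a 0) := by ext; ring
    rw [h3, integral_sub, integral_const_mul, h1, h2]
    · simp
    · exact (hμ.integrable_eval (X * (X - C (a 0)))).congr
        (ae_of_all _ fun y => by simp)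
    · exact (hμ.integrable_eval (C (a 0) * (X - C (a 0)))).congr
        (ae_of_all _ fun y => by simp)
  · rw [Pi.single_eq_of_ne hn]
    exact hμ.orthogonal 1 n hn.symm

/-! ### Compact support, convergence of moments, uniqueness -/

/-- Markov's inequality for the moment of order `2k` gives `μ(|y| ≥ ρ) ≤ (R/ρ)^(2k)`, which tends to
0 for `ρ > R`. -/
theorem ae_abs_le_of_integral_pow_le {μ : Measure ℝ} [IsFiniteMeasure μ] {R : ℝ} (hR : 0 ≤ R)
    (hi : ∀ k : ℕ, Integrable (fun y => y ^ k) μ)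
    (h : ∀ k : ℕ, |∫ y, y ^ k ∂μ| ≤ R ^ k) : ∀ᵐ y ∂μ, |y| ≤ R := by
  have key : ∀ ρ, R < ρ → ∀ᵐ y ∂μ, |y| < ρ := by
    intro ρ hρ
    have hρ0 : 0 < ρ := hR.trans_lt hρ
    have hb : ∀ k : ℕ, μ.real {y | ρ ≤ |y|} ≤ ((R / ρ) ^ 2) ^ k := by
      intro k
      rcases Nat.eq_zero_or_pos k with rfl | hk
      · have h0 := mul_meas_ge_le_integral_of_nonneg (μ := μ) (f := fun _ : ℝ => (1 : ℝ))
          (ae_of_all _ fun _ => zero_le_one) (integrable_const _) 1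
        have h1 := (le_abs_self _).trans (h 0)
        simp only [pow_zero] at h1 ⊢
        exact (measureReal_mono (Set.subset_univ _)).trans (by simpa using h1)
      · have h0 := mul_meas_ge_le_integral_of_nonneg (μ := μ) (f := fun y : ℝ => y ^ (2 * k))
          (ae_of_all _ fun y => by simp only [pow_mul]; positivity) (hi _) (ρ ^ (2 * k))
        have h1 : {y : ℝ | ρ ^ (2 * k) ≤ y ^ (2 * k)} = {y | ρ ≤ |y|} := by
          ext y
          simp only [Set.mem_ofPred_eq]
          rw [← (even_two_mul k).pow_abs y]
          exact pow_le_pow_iff_left₀ hρ0.le (abs_nonneg y) (by omega)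
        rw [h1] at h0
        have h2 := h0.trans ((le_abs_self _).trans (h (2 * k)))
        rw [← pow_mul, div_pow, le_div_iff₀ (by positivity)]
        linarith
    have h0 : μ.real {y | ρ ≤ |y|} ≤ 0 := by
      refine ge_of_tendsto' (tendsto_pow_atTop_nhds_zero_of_lt_one (by positivity) ?_) hb
      have : R / ρ < 1 := (div_lt_one hρ0).2 hρ
      have : 0 ≤ R / ρ := by positivity
      nlinarith
    rw [ae_iff]
    simp only [not_lt]
    rw [← measureReal_eq_zero_iff]
    exact le_antisymm h0 measureReal_nonneg
  have := ae_all_iff.2 fun n : ℕ => key (R + 1 / ((n : ℝ) + 1))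
    (lt_add_of_pos_right _ (by positivity))
  filter_upwards [this] with y hy
  have hlim := (tendsto_const_nhds (x := R)).add tendsto_one_div_add_atTop_nhds_zero_nat
  rw [add_zero] at hlim
  exact ge_of_tendsto' hlim fun n => (hy n).le

theorem abs_pi_single_one_le (i n : ℕ) : |(Pi.single i 1 : ℕ → ℝ) n| ≤ 1 := by
  rw [Pi.single_apply]
  split_ifs <;> simp

theorem IsOrthogonalityMeasure.ae_abs_le {a b : ℕ → ℝ} {μ : Measure ℝ} {A B : ℝ}
    (hμ : IsOrthogonalityMeasure (favardPoly a b) μ) (ha : ∀ n, |a n| ≤ A)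
    (hb : ∀ n, |b n| ≤ B) : ∀ᵐ y ∂μ, |y| ≤ 1 + A + B := by
  have := hμ.isProbabilityMeasure
  have hA : 0 ≤ A := (abs_nonneg _).trans (ha 0)
  have hB : 0 ≤ B := (abs_nonneg _).trans (hb 0)
  refine ae_abs_le_of_integral_pow_le (by positivity)
    (fun k => by simpa using hμ.integrable_eval (X ^ k)) fun k => ?_
  rw [hμ.integral_pow]
  exact abs_jacobiStep_iterate_le ha hb (abs_pi_single_one_le 0) k 0

theorem integrable_of_ae_abs_le {μ : Measure ℝ} [IsFiniteMeasure μ] {R : ℝ}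
    (h : ∀ᵐ y ∂μ, |y| ≤ R) {g : ℝ → ℝ} (hg : Continuous g) : Integrable g μ := by
  obtain ⟨K, hK⟩ := isCompact_Icc.exists_bound_of_continuousOn
    (s := Set.Icc (-R) R) hg.continuousOn
  refine Integrable.of_bound hg.aestronglyMeasurable K ?_
  filter_upwards [h] with y hy
  exact hK y (abs_le.1 hy)

/-- On the common interval `[-R, R]` a polynomial lies within `ε/3` of `g`, and polynomial integrals
are finite combinations of moments. -/
theorem tendsto_integral_of_tendsto_moments {ι : Type*} {l : Filter ι} {κ : ι → Measure ℝ}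
    {ν : Measure ℝ} {R : ℝ} (hκ : ∀ᶠ i in l, IsProbabilityMeasure (κ i))
    (hν : IsProbabilityMeasure ν) (hκR : ∀ᶠ i in l, ∀ᵐ y ∂κ i, |y| ≤ R)
    (hνR : ∀ᵐ y ∂ν, |y| ≤ R)
    (hm : ∀ k : ℕ, Tendsto (fun i => ∫ y, y ^ k ∂κ i) l (𝓝 (∫ y, y ^ k ∂ν)))
    {g : ℝ → ℝ} (hg : Continuous g) :
    Tendsto (fun i => ∫ y, g y ∂κ i) l (𝓝 (∫ y, g y ∂ν)) := by
  rw [Metric.tendsto_nhds]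
  intro ε hε
  obtain ⟨p, hp⟩ := exists_polynomial_near_of_continuousOn (-R) R g hg.continuousOn (ε / 3)
    (by positivity)
  have near : ∀ m : Measure ℝ, IsProbabilityMeasure m → (∀ᵐ y ∂m, |y| ≤ R) →
      |∫ y, p.eval y ∂m - ∫ y, g y ∂m| ≤ ε / 3 := by
    intro m hm1 hmR
    rw [← integral_sub (integrable_of_ae_abs_le hmR p.continuous)
      (integrable_of_ae_abs_le hmR hg)]
    have : ∀ᵐ y ∂m, ‖p.eval y - g y‖ ≤ ε / 3 := by
      filter_upwards [hmR] with y hy using (hp y (abs_le.1 hy)).le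
    simpa using norm_integral_le_of_norm_le_const this
  have expand : ∀ m : Measure ℝ, IsProbabilityMeasure m → (∀ᵐ y ∂m, |y| ≤ R) →
      ∫ y, p.eval y ∂m = ∑ k ∈ Finset.range (p.natDegree + 1), p.coeff k * ∫ y, y ^ k ∂m := by
    intro m hm1 hmR
    simp_rw [eval_eq_sum_range]
    rw [integral_finsetSum]
    · simp_rw [integral_const_mul]
    · exact fun k _ => (integrable_of_ae_abs_le hmR (continuous_pow k)).const_mul _
  have hlim : Tendsto (fun i => ∑ k ∈ Finset.range (p.natDegree + 1),
      p.coeff k * ∫ y, y ^ k ∂κ i) l (𝓝 (∫ y, p.eval y ∂ν)) := by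
    rw [expand ν hν hνR]
    exact tendsto_finsetSum _ fun k _ => (hm k).const_mul _
  filter_upwards [hκ, hκR, Metric.tendsto_nhds.1 hlim (ε / 3) (by positivity)] with i h1 h2 h3
  rw [← expand _ h1 h2, Real.dist_eq] at h3
  rw [Real.dist_eq]
  have h4 := abs_le.1 (near _ h1 h2)
  have h5 := abs_le.1 (near ν hν hνR)
  have h6 := abs_lt.1 h3
  rw [abs_lt]
  constructor <;> linarith [h4.1, h4.2, h5.1, h5.2, h6.1, h6.2]

theorem IsOrthogonalityMeasure.eq_of_bounded {a b : ℕ → ℝ} {μ ν : Measure ℝ} {A B : ℝ}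
    (hμ : IsOrthogonalityMeasure (favardPoly a b) μ)
    (hν : IsOrthogonalityMeasure (favardPoly a b) ν) (ha : ∀ n, |a n| ≤ A)
    (hb : ∀ n, |b n| ≤ B) : μ = ν := by
  have := hμ.isProbabilityMeasure
  have := hν.isProbabilityMeasure
  refine ext_of_forall_integral_eq_of_IsFiniteMeasure fun f => ?_
  -- A constant family with the moments of `ν` converges to `ν`; uniqueness of limits identifies the
  -- two integrals.
  have h := tendsto_integral_of_tendsto_moments (l := (atTop : Filter ℕ)) (κ := fun _ => μ)
    (Eventually.of_forall fun _ => hμ.isProbabilityMeasure) hν.isProbabilityMeasure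
    (Eventually.of_forall fun _ => hμ.ae_abs_le ha hb) (hν.ae_abs_le ha hb)
    (fun k => by rw [hμ.integral_pow, hν.integral_pow]; exact tendsto_const_nhds) f.continuous
  exact tendsto_nhds_unique tendsto_const_nhds h


/-! ### Existence: Gauss quadrature and weak compactness -/

/-- The truncated symmetric Jacobi matrix with diagonal `a` and off-diagonal entries `c`. -/
def jacobiMatrix (a c : ℕ → ℝ) (N : ℕ) : Matrix (Fin N) (Fin N) ℝ := fun i j =>
  (if (i : ℕ) = j then a i else 0) + (if (i : ℕ) + 1 = j then c i else 0)
    + (if (j : ℕ) + 1 = i then c j else 0)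

theorem jacobiMatrix_isHermitian (a c : ℕ → ℝ) (N : ℕ) : (jacobiMatrix a c N).IsHermitian := by
  ext i j
  simp only [Matrix.conjTranspose_apply, star_trivial, jacobiMatrix]
  by_cases h : (i : ℕ) = j
  · simp [h]
  · simp [h, Ne.symm h]
    ring

theorem sum_ite_le_of_nonneg {N : ℕ} {C : ℝ} (hC : 0 ≤ C) (P : Fin N → Prop)
    [DecidablePred P] (hP : ∀ i j, P i → P j → i = j) : ∑ j, (if P j then C else 0) ≤ C := by
  by_cases h : ∃ i, P i
  · obtain ⟨i, hi⟩ := h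
    rw [Finset.sum_eq_single i (fun j _ hj => if_neg fun h' => hj (hP _ _ h' hi)) (by simp)]
    simp [hi]
  · push Not at h
    simpa [h] using hC

/-- Gershgorin's theorem: each row has at most two off-diagonal entries, each bounded by `B`. -/
theorem abs_jacobiMatrix_eigenvalues_le {a c : ℕ → ℝ} {A B : ℝ} (ha : ∀ n, |a n| ≤ A)
    (hc : ∀ n, |c n| ≤ B) (N : ℕ) (i : Fin N) :
    |(jacobiMatrix_isHermitian a c N).eigenvalues i| ≤ A + 2 * B := by
  set hJ := jacobiMatrix_isHermitian a c N
  have hB : 0 ≤ B := (abs_nonneg _).trans (hc 0)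
  have hev : Module.End.HasEigenvalue (Matrix.toLin' (jacobiMatrix a c N))
      (hJ.eigenvalues i) := by
    refine Module.End.hasEigenvalue_of_hasEigenvector (x := ⇑(hJ.eigenvectorBasis i))
      ⟨Module.End.mem_eigenspace_iff.2 ?_, ?_⟩
    · rw [Matrix.toLin'_apply]
      exact hJ.mulVec_eigenvectorBasis i
    · intro h0
      refine hJ.eigenvectorBasis.toBasis.ne_zero i ?_
      ext j
      simpa using congr_fun h0 j
  obtain ⟨k, hk⟩ := eigenvalue_mem_ball hev
  rw [Metric.mem_closedBall, Real.dist_eq] at hk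
  have hdiag : jacobiMatrix a c N k k = a k := by simp [jacobiMatrix]
  have hsum : ∑ j ∈ Finset.univ.erase k, ‖jacobiMatrix a c N k j‖ ≤ 2 * B := by
    calc ∑ j ∈ Finset.univ.erase k, ‖jacobiMatrix a c N k j‖
        ≤ ∑ j ∈ Finset.univ.erase k, ((if (k : ℕ) + 1 = j then B else 0)
            + (if (j : ℕ) + 1 = k then B else 0)) := by
          refine Finset.sum_le_sum fun j hj => ?_
          have hne : (k : ℕ) ≠ j := fun h => (Finset.ne_of_mem_erase hj) (Fin.ext h.symm)
          rw [jacobiMatrix, if_neg hne, zero_add]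
          refine (norm_add_le _ _).trans (add_le_add ?_ ?_) <;> split_ifs <;>
            simp [hc]
      _ ≤ ∑ j : Fin N, ((if (k : ℕ) + 1 = j then B else 0)
            + (if (j : ℕ) + 1 = k then B else 0)) := by
          refine Finset.sum_le_sum_of_subset_of_nonneg (Finset.erase_subset _ _) fun j _ _ => ?_
          positivity
      _ ≤ B + B := by
          rw [Finset.sum_add_distrib]
          exact add_le_add (sum_ite_le_of_nonneg hB _ fun i j h1 h2 => Fin.ext (by omega))
            (sum_ite_le_of_nonneg hB _ fun i j h1 h2 => Fin.ext (by omega))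
      _ = 2 * B := by ring
  rw [hdiag] at hk
  have h1 := abs_sub_abs_le_abs_sub (hJ.eigenvalues i) (a k)
  linarith [ha k]

/-- Extension of a vector by zero to a sequence. -/
def extendZero {N : ℕ} (v : Fin N → ℝ) (n : ℕ) : ℝ := if h : n < N then v ⟨n, h⟩ else 0

theorem jacobiMatrix_mulVec {a c : ℕ → ℝ} {N : ℕ} (v : Fin N → ℝ) (i : Fin N) :
    (jacobiMatrix a c N).mulVec v i = a i * extendZero v i + c i * extendZero v (i + 1)
      + ∑ j ∈ Finset.range N, (if j + 1 = (i : ℕ) then c j * extendZero v j else 0) := by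
  have hv : ∀ j : Fin N, v j = extendZero v j := fun j => by simp [extendZero]
  have hi := i.2
  have h : (jacobiMatrix a c N).mulVec v i = ∑ j ∈ Finset.range N,
      (((if (i : ℕ) = j then a i * extendZero v j else 0)
        + (if (i : ℕ) + 1 = j then c i * extendZero v j else 0))
        + (if j + 1 = (i : ℕ) then c j * extendZero v j else 0)) := by
    rw [← Fin.sum_univ_eq_sum_range, Matrix.mulVec, dotProduct]
    refine Finset.sum_congr rfl fun j _ => ?_
    rw [jacobiMatrix, ← hv]
    simp only [add_mul, ite_mul, zero_mul]
  rw [h, Finset.sum_add_distrib, Finset.sum_add_distrib, Finset.sum_ite_eq, Finset.sum_ite_eq,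
    if_pos (Finset.mem_range.2 hi)]
  congr 2
  split_ifs with h1
  · rfl
  · rw [Finset.mem_range] at h1
    simp [extendZero, h1]

/-- The rows of the eigenvalue equation are the recurrence in orthonormal scaling. Stating it as a
product avoids dividing by `√(b k)` or `v 0`. The truncated last row is never used. -/
theorem favardPoly_eval_of_eigenvector {a b : ℕ → ℝ} (hb : ∀ n, 0 ≤ b n) {N : ℕ}
    {v : Fin N → ℝ} {lam : ℝ}
    (hv : (jacobiMatrix a (fun n => √(b n)) N).mulVec v = lam • v) (n : ℕ) (hn : n < N) :
    (favardPoly a b n).eval lam * extendZero v 0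
      = (∏ k ∈ Finset.range n, √(b k)) * extendZero v n := by
  have hrec : ∀ i (hi : i < N), lam * extendZero v i
      = a i * extendZero v i + √(b i) * extendZero v (i + 1)
      + ∑ j ∈ Finset.range N, (if j + 1 = i then √(b j) * extendZero v j else 0) := by
    intro i hi
    have h := jacobiMatrix_mulVec (a := a) (c := fun n => √(b n)) v ⟨i, hi⟩
    rw [hv] at h
    rw [← h]
    simp [extendZero, hi]
  induction n using Nat.twoStepInduction with
  | zero => simp [favardPoly]
  | one =>
    have h := hrec 0 (by omega)
    simp only [Nat.add_eq_zero_iff, one_ne_zero, and_false, if_false, Finset.sum_const_zero,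
      add_zero, zero_add] at h
    simp only [favardPoly, eval_sub, eval_X, eval_C, Finset.prod_range_one]
    linarith
  | more n ih0 ih1 =>
    have h0 := ih0 (by omega)
    have h1 := ih1 (by omega)
    have h := hrec (n + 1) (by omega)
    simp only [Nat.add_right_cancel_iff] at h
    rw [Finset.sum_ite_eq', if_pos (Finset.mem_range.2 (by omega))] at h
    simp only [favardPoly, eval_sub, eval_mul, eval_X, eval_C]
    have hs := Real.mul_self_sqrt (hb n)
    simp only [Finset.prod_range_succ] at h0 h1 ⊢
    set π := ∏ k ∈ Finset.range n, √(b k)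
    linear_combination (lam - a (n + 1)) * h1 - b n * h0 + π * √(b n) * h
      + π * extendZero v n * hs

theorem exists_quadrature {a b : ℕ → ℝ} {A B : ℝ} (ha : ∀ n, |a n| ≤ A) (hb : ∀ n, 0 ≤ b n)
    (hB : ∀ n, √(b n) ≤ B) (N : ℕ) :
    ∃ μ : ProbabilityMeasure (Set.Icc (-(A + 2 * B)) (A + 2 * B)),
      ∀ m n, m < N → n < N → m ≠ n →
        ∫ y, (favardPoly a b m).eval (y : ℝ) * (favardPoly a b n).eval (y : ℝ)
          ∂(μ : Measure (Set.Icc (-(A + 2 * B)) (A + 2 * B))) = 0 := by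
  -- Size `N + 1` guarantees an index 0, so the weights have total mass 1 even for `N = 0`.
  set J := jacobiMatrix a (fun n => √(b n)) (N + 1)
  set hJ : J.IsHermitian := jacobiMatrix_isHermitian a (fun n => √(b n)) (N + 1)
  have hle : ∀ i, |hJ.eigenvalues i| ≤ A + 2 * B := abs_jacobiMatrix_eigenvalues_le ha
    (fun n => by rw [abs_of_nonneg (Real.sqrt_nonneg _)]; exact hB n) (N + 1)
  let lam : Fin (N + 1) → Set.Icc (-(A + 2 * B)) (A + 2 * B) :=
    fun i => ⟨hJ.eigenvalues i, abs_le.1 (hle i)⟩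
  let w : Fin (N + 1) → Fin (N + 1) → ℝ := fun i k => hJ.eigenvectorBasis i k
  -- The rows, not the columns, of the orthogonal eigenvector matrix: the sum runs over
  -- eigenvectors.
  have horth : ∀ m n : Fin (N + 1), ∑ i, w i m * w i n = if m = n then 1 else 0 := by
    intro m n
    have h := congr_fun₂ (Matrix.mem_unitaryGroup_iff.1 hJ.eigenvectorUnitary.2) m n
    rw [Matrix.mul_apply, Matrix.one_apply] at h
    rw [← h]
    rfl
  have hmass : ∑ i, w i 0 ^ 2 = 1 := by
    have := horth 0 0
    simp only [if_true] at this
    rw [← this]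
    exact Finset.sum_congr rfl fun i _ => sq _
  let μ : Measure (Set.Icc (-(A + 2 * B)) (A + 2 * B)) :=
    ∑ i, ENNReal.ofReal (w i 0 ^ 2) • Measure.dirac (lam i)
  have hμ : IsProbabilityMeasure μ := by
    constructor
    simp only [μ, Measure.coe_finsetSum, Finset.sum_apply, Measure.smul_apply, measure_univ,
      smul_eq_mul, mul_one]
    rw [← ENNReal.ofReal_sum_of_nonneg fun i _ => sq_nonneg _, hmass, ENNReal.ofReal_one]
  refine ⟨⟨μ, hμ⟩, fun m n hm hn hmn => ?_⟩
  change ∫ y, _ ∂μ = 0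
  rw [integral_finsetSum_measure]
  · simp_rw [integral_smul_measure, integral_dirac,
      ENNReal.toReal_ofReal (sq_nonneg _), smul_eq_mul]
    have hkey : ∀ i k, k < N → (favardPoly a b k).eval (lam i : ℝ) * w i 0
        = (∏ l ∈ Finset.range k, √(b l)) * extendZero (w i) k := by
      intro i k hk
      exact favardPoly_eval_of_eigenvector hb (hJ.mulVec_eigenvectorBasis i) k (by omega)
    have hex : ∀ i k (hk : k < N), extendZero (w i) k = w i ⟨k, by omega⟩ := fun i k hk =>
      dif_pos (by omega)
    have h := horth ⟨m, by omega⟩ ⟨n, by omega⟩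
    rw [if_neg (by simpa using hmn)] at h
    calc ∑ i, w i 0 ^ 2 * ((favardPoly a b m).eval (lam i : ℝ)
          * (favardPoly a b n).eval (lam i : ℝ))
        = ∑ i, ((∏ l ∈ Finset.range m, √(b l)) * ∏ l ∈ Finset.range n, √(b l))
          * (w i ⟨m, by omega⟩ * w i ⟨n, by omega⟩) := by
          refine Finset.sum_congr rfl fun i _ => ?_
          rw [← hex i m hm, ← hex i n hn]
          linear_combination (favardPoly a b n).eval (lam i : ℝ) * w i 0 * hkey i m hm
            + (∏ l ∈ Finset.range m, √(b l)) * extendZero (w i) m * hkey i n hn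
      _ = 0 := by rw [← Finset.mul_sum, h, mul_zero]
  · intro i _
    exact (integrable_dirac (by finiteness)).smul_measure ENNReal.ofReal_ne_top

theorem exists_isOrthogonalityMeasure_favardPoly {a b : ℕ → ℝ} {A B : ℝ} (ha : ∀ n, |a n| ≤ A)
    (hb : ∀ n, 0 ≤ b n) (hB : ∀ n, √(b n) ≤ B) :
    ∃ μ, IsOrthogonalityMeasure (favardPoly a b) μ := by
  choose μ hμ using exists_quadrature ha hb hB
  -- Probability measures on a compact interval form a compact space, so the quadratures converge
  -- along an ultrafilter; each orthogonality relation holds for all large `N` and passes to the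
  -- limit.
  set F : Ultrafilter (ProbabilityMeasure (Set.Icc (-(A + 2 * B)) (A + 2 * B))) :=
    (hyperfilter ℕ).map μ
  obtain ⟨ν, -, hν⟩ := isCompact_univ.ultrafilter_le_nhds F (by simp)
  have hlim : Tendsto μ (hyperfilter ℕ : Filter ℕ) (𝓝 ν) := hν
  rw [ProbabilityMeasure.tendsto_iff_forall_integral_tendsto] at hlim
  have hval := MeasurableEmbedding.subtype_coe (measurableSet_Icc (a := -(A + 2 * B))
    (b := A + 2 * B))
  refine ⟨(ν : Measure (Set.Icc (-(A + 2 * B)) (A + 2 * B))).map Subtype.val, ?_, fun r => ?_, fun m n hmn => ?_⟩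
  · exact Measure.isProbabilityMeasure_map hval.measurable.aemeasurable
  · rw [hval.integrable_map_iff]
    exact (BoundedContinuousFunction.mkOfCompact
      ⟨fun y : Set.Icc (-(A + 2 * B)) (A + 2 * B) => r.eval (y : ℝ), by fun_prop⟩).integrable _
  · rw [hval.integral_map]
    have h := hlim (BoundedContinuousFunction.mkOfCompact
      ⟨fun y => (favardPoly a b m).eval (y : ℝ) * (favardPoly a b n).eval (y : ℝ), by fun_prop⟩)
    refine tendsto_nhds_unique h (tendsto_const_nhds.congr' ?_)
    have : ∀ᶠ N in (hyperfilter ℕ : Filter ℕ), max m n < N := by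
      refine Filter.Eventually.filter_mono ?_ (eventually_gt_atTop (max m n))
      rw [← Nat.cofinite_eq_atTop]
      exact hyperfilter_le_cofinite
    filter_upwards [this] with N hN
    exact (hμ N m n ((le_max_left _ _).trans_lt hN) ((le_max_right _ _).trans_lt hN) hmn).symm


/-! ### The tilted measure and its limit as `b 0 → 0` -/

/-- The measure with density `p_1² / b_0` with respect to `μ`, which is a probability measure if
`μ` is an orthogonality measure of the polynomials `p_n`. -/
def squareTilt (a b : ℕ → ℝ) (μ : Measure ℝ) : Measure ℝ :=
  μ.withDensity fun y => ENNReal.ofReal ((y - a 0) ^ 2 / b 0)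

theorem integral_squareTilt {a b : ℕ → ℝ} (hb : 0 < b 0) (μ : Measure ℝ) (g : ℝ → ℝ) :
    ∫ y, g y ∂squareTilt a b μ = ∫ y, (y - a 0) ^ 2 / b 0 * g y ∂μ := by
  rw [squareTilt, integral_withDensity_eq_integral_toReal_smul (by fun_prop) (by simp)]
  congr 1 with y
  rw [ENNReal.toReal_ofReal (by positivity), smul_eq_mul]

theorem IsOrthogonalityMeasure.integral_pow_squareTilt {a b : ℕ → ℝ} {μ : Measure ℝ}
    (hμ : IsOrthogonalityMeasure (favardPoly a b) μ) (hb : 0 < b 0) (k : ℕ) :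
    ∫ y, y ^ k ∂squareTilt a b μ = (jacobiStep a b)^[k] (Pi.single 1 1) 1 := by
  have h := integral_pow_mul_favardPoly (a := a) (b := b) hμ.integrable_eval
    (C (b 0)⁻¹ * favardPoly a b 1) k 1
  have h1 : (fun n => ∫ y, (C (b 0)⁻¹ * favardPoly a b 1).eval y * (favardPoly a b n).eval y ∂μ)
      = Pi.single 1 1 := by
    ext n
    simp only [eval_mul, eval_C, mul_assoc]
    rw [integral_const_mul, congr_fun hμ.integral_favardPoly_one n, Pi.single_apply,
      Pi.single_apply]
    split_ifs
    · exact inv_mul_cancel₀ hb.ne'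
    · exact mul_zero _
  rw [h1] at h
  rw [integral_squareTilt hb, ← h]
  congr 1 with y
  simp only [favardPoly, eval_mul, eval_C, eval_sub, eval_X]
  ring

theorem IsOrthogonalityMeasure.isProbabilityMeasure_squareTilt {a b : ℕ → ℝ} {μ : Measure ℝ}
    (hμ : IsOrthogonalityMeasure (favardPoly a b) μ) (hb : 0 < b 0) :
    IsProbabilityMeasure (squareTilt a b μ) := by
  have h := hμ.integral_pow_squareTilt hb 0
  rw [integral_squareTilt hb] at h
  simp only [pow_zero, mul_one, Function.iterate_zero, id_eq, Pi.single_eq_same] at h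
  constructor
  rw [squareTilt, withDensity_apply _ MeasurableSet.univ, Measure.restrict_univ,
    ← ofReal_integral_eq_lintegral_ofReal, h, ENNReal.ofReal_one]
  · exact (hμ.integrable_eval (C (b 0)⁻¹ * (X - C (a 0)) ^ 2)).congr
      (ae_of_all _ fun y => by simp [div_eq_inv_mul])
  · exact ae_of_all _ fun y => by positivity

theorem tendsto_integral_squareTilt {ι : Type*} {l : Filter ι} {a b : ι → ℕ → ℝ}
    {a' b' : ℕ → ℝ} {A B : ℝ} {μ : ι → Measure ℝ} {ν : Measure ℝ}
    (hμ : ∀ᶠ i in l, IsOrthogonalityMeasure (favardPoly (a i) (b i)) (μ i))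
    (hν : IsOrthogonalityMeasure (favardPoly (fun n => a' (n + 1)) (fun n => b' (n + 1))) ν)
    (hb0 : ∀ᶠ i in l, 0 < b i 0) (hb0' : b' 0 = 0)
    (haA : ∀ᶠ i in l, ∀ n, |a i n| ≤ A) (hbB : ∀ᶠ i in l, ∀ n, |b i n| ≤ B)
    (haA' : ∀ n, |a' n| ≤ A) (hbB' : ∀ n, |b' n| ≤ B)
    (ha : ∀ n, Tendsto (fun i => a i n) l (𝓝 (a' n)))
    (hb : ∀ n, Tendsto (fun i => b i n) l (𝓝 (b' n))) {g : ℝ → ℝ} (hg : Continuous g) :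
    Tendsto (fun i => ∫ y, g y ∂squareTilt (a i) (b i) (μ i)) l (𝓝 (∫ y, g y ∂ν)) := by
  refine tendsto_integral_of_tendsto_moments (R := 1 + A + B) ?_ hν.isProbabilityMeasure ?_
    (hν.ae_abs_le (fun n => haA' (n + 1)) fun n => hbB' (n + 1)) (fun k => ?_) hg
  · filter_upwards [hμ, hb0] with i h1 h2 using h1.isProbabilityMeasure_squareTilt h2
  · filter_upwards [hμ, haA, hbB] with i h1 h2 h3
    exact (withDensity_absolutelyContinuous _ _).ae_le (h1.ae_abs_le h2 h3)
  · rw [hν.integral_pow]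
    have h := tendsto_jacobiStep_iterate ha hb (Pi.single 1 1) k 1
    have hs : (fun n => (Pi.single 1 1 : ℕ → ℝ) (n + 1)) = Pi.single 0 1 := by
      ext n
      simp [Pi.single_apply]
    -- The limit of `(J^k e_1)_1` becomes `(J'^k e_0)_0` for the shifted operator `J'`.
    rw [jacobiStep_iterate_shift hb0', hs] at h
    refine h.congr' ?_
    filter_upwards [hμ, hb0] with i h1 h2 using (h1.integral_pow_squareTilt h2 k).symm

/-! ### The second-order Taylor remainder -/

theorem hasDerivAt_of_contDiff_two {f : ℝ → ℝ} (hf : ContDiff ℝ 2 f) :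
    (∀ x, HasDerivAt f (deriv f x) x) ∧ (∀ x, HasDerivAt (deriv f) (deriv (deriv f) x) x) ∧
      Continuous (deriv (deriv f)) := by
  have h1 : ContDiff ℝ 1 (deriv f) :=
    ((contDiff_succ_iff_deriv (n := 1)).1 (by simpa [one_add_one_eq_two] using hf)).2.2
  exact ⟨fun x => (hf.differentiable (by simp) x).hasDerivAt,
    fun x => (h1.differentiable (by simp) x).hasDerivAt, h1.continuous_deriv le_rfl⟩

theorem taylor_two_integral {f : ℝ → ℝ} (hf : ContDiff ℝ 2 f) (x y : ℝ) :
    f y - f x - deriv f x * (y - x)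
      = (y - x) ^ 2 * ∫ θ in (0 : ℝ)..1, (1 - θ) * deriv (deriv f) (x + θ * (y - x)) := by
  obtain ⟨h1, h2, h3⟩ := hasDerivAt_of_contDiff_two hf
  have hline : ∀ θ : ℝ, HasDerivAt (fun θ => x + θ * (y - x)) (y - x) θ := fun θ => by
    simpa using ((hasDerivAt_id θ).mul_const (y - x)).const_add x
  have hd : ∀ θ ∈ Set.uIcc (0 : ℝ) 1, HasDerivAt
      (fun θ => f (x + θ * (y - x)) + (1 - θ) * (deriv f (x + θ * (y - x)) * (y - x)))
      ((y - x) ^ 2 * ((1 - θ) * deriv (deriv f) (x + θ * (y - x)))) θ := by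
    intro θ _
    have e1 := (h1 (x + θ * (y - x))).comp θ (hline θ)
    have e2 := ((h2 (x + θ * (y - x))).comp θ (hline θ)).mul_const (y - x)
    have e3 := e1.add (((hasDerivAt_id θ).const_sub 1).mul e2)
    refine e3.congr_deriv ?_
    simp only [id_eq, Function.comp_apply]
    ring
  have h := intervalIntegral.integral_eq_sub_of_hasDerivAt hd
    (Continuous.intervalIntegrable (by fun_prop) _ _)
  rw [intervalIntegral.integral_const_mul] at h
  rw [h]
  simp only [one_mul, add_sub_cancel, sub_self, zero_mul, add_zero, sub_zero]
  ring

/-- This form covers `y = x` as well, so continuity in `y` and the bound by `f''` need no case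
distinction. -/
theorem derivDividedDifference_eq_integral {f : ℝ → ℝ} (hf : ContDiff ℝ 2 f) (x y : ℝ) :
    derivDividedDifference f x y
      = ∫ θ in (0 : ℝ)..1, (1 - θ) * deriv (deriv f) (x + θ * (y - x)) := by
  rw [derivDividedDifference]
  split_ifs with hxy
  · subst hxy
    simp only [sub_self, mul_zero, add_zero]
    rw [intervalIntegral.integral_mul_const, intervalIntegral.integral_sub (by simp) (by simp)]
    simp only [intervalIntegral.integral_const, integral_id]
    norm_num
    ring
  · have hne : y - x ≠ 0 := sub_ne_zero.2 hxy
    have hd := (((hasDerivAt_of_contDiff_two hf).1 x).const_sub (f y)).div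
      ((hasDerivAt_id x).const_sub y) hne
    have ht := taylor_two_integral hf x y
    refine hd.deriv.trans ?_
    simp only [id_eq]
    rw [div_eq_iff (pow_ne_zero 2 hne)]
    linear_combination ht

theorem taylor_two_derivDividedDifference {f : ℝ → ℝ} (hf : ContDiff ℝ 2 f) (x y : ℝ) :
    f y = f x + deriv f x * (y - x) + (y - x) ^ 2 * derivDividedDifference f x y := by
  rw [derivDividedDifference_eq_integral hf, ← taylor_two_integral hf]
  ring

theorem continuous_derivDividedDifference {f : ℝ → ℝ} (hf : ContDiff ℝ 2 f) (x : ℝ) :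
    Continuous (derivDividedDifference f x) := by
  have h3 := (hasDerivAt_of_contDiff_two hf).2.2
  rw [funext (derivDividedDifference_eq_integral hf x)]
  exact intervalIntegral.continuous_parametric_intervalIntegral_of_continuous'
    (by fun_prop) _ _

theorem abs_derivDividedDifference_le {f : ℝ → ℝ} (hf : ContDiff ℝ 2 f) {K : ℝ}
    (hK : ∀ x, |deriv (deriv f) x| ≤ K) (x y : ℝ) : |derivDividedDifference f x y| ≤ K := by
  rw [derivDividedDifference_eq_integral hf]
  have hK0 : 0 ≤ K := (abs_nonneg _).trans (hK 0)
  have h := intervalIntegral.norm_integral_le_of_norm_le_const (a := (0 : ℝ)) (b := 1) (C := K)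
    (f := fun θ => (1 - θ) * deriv (deriv f) (x + θ * (y - x))) fun θ hθ => by
      rw [Set.uIoc_of_le zero_le_one] at hθ
      rw [norm_mul]
      refine (mul_le_mul ?_ (hK _) (abs_nonneg _) zero_le_one).trans (one_mul K).le
      rw [Real.norm_eq_abs, abs_le]
      constructor <;> linarith [hθ.1, hθ.2]
  simpa using h

theorem IsOrthogonalityMeasure.integral_sub_eq {a b : ℕ → ℝ} {μ : Measure ℝ} {A B : ℝ}
    (hμ : IsOrthogonalityMeasure (favardPoly a b) μ) (hb0 : 0 < b 0) (ha : ∀ n, |a n| ≤ A)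
    (hb : ∀ n, |b n| ≤ B) {f : ℝ → ℝ} (hf : ContDiff ℝ 2 f) :
    1 / b 0 * (∫ y, f y ∂μ - f (a 0))
      = ∫ y, derivDividedDifference f (a 0) y ∂squareTilt a b μ := by
  have := hμ.isProbabilityMeasure
  have hR := hμ.ae_abs_le ha hb
  have hg := continuous_derivDividedDifference hf (a 0)
  have h1 : ∫ y, (y - a 0) ∂μ = 0 := by
    simpa [favardPoly] using hμ.orthogonal 0 1 zero_ne_one
  have h2 : ∫ y, f y ∂μ
      = f (a 0) + ∫ y, (y - a 0) ^ 2 * derivDividedDifference f (a 0) y ∂μ := by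
    calc ∫ y, f y ∂μ = ∫ y, ((f (a 0) + deriv f (a 0) * (y - a 0))
          + (y - a 0) ^ 2 * derivDividedDifference f (a 0) y) ∂μ := by
          congr 1 with y
          exact taylor_two_derivDividedDifference hf (a 0) y
      _ = _ := by
          rw [integral_add (integrable_of_ae_abs_le hR (by fun_prop))
            (integrable_of_ae_abs_le hR (by fun_prop)),
            integral_add (integrable_const _) (integrable_of_ae_abs_le hR (by fun_prop)),
            integral_const_mul, h1]
          simp
  rw [h2, integral_squareTilt hb0, add_sub_cancel_left, ← integral_const_mul]
  congr 1 with y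
  ring


/-! ### The recurrence of the `q`-Wiener process -/

theorem qNum_mul_one_sub (q : ℝ) (n : ℕ) : qNum q n * (1 - q) = 1 - q ^ n :=
  geom_sum_mul_neg q n

/-- Diagonal recurrence coefficients of the polynomials `polyQ 0 0 q x s t`. -/
def wienerDiag (q x : ℝ) (n : ℕ) : ℝ := x * q ^ n

/-- Off-diagonal recurrence coefficients of the polynomials `polyQ 0 0 q x s t`. -/
def wienerOffDiag (q s t : ℝ) (n : ℕ) : ℝ := (t - s * q ^ n) * qNum q (n + 1)

theorem polyQ_eq_favardPoly (q x s t : ℝ) :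
    polyQ 0 0 q x s t = favardPoly (wienerDiag q x) (wienerOffDiag q s t) := by
  ext1 n
  induction n using Nat.twoStepInduction with
  | zero => rfl
  | one => simp [polyQ, favardPoly, wienerDiag]
  | more n h0 h1 => simp [polyQ, favardPoly, wienerDiag, wienerOffDiag, h0, h1]

theorem wienerOffDiag_zero (q s t : ℝ) : wienerOffDiag q s t 0 = t - s := by
  simp [wienerOffDiag, qNum]

theorem wienerDiag_mul (q x : ℝ) : wienerDiag q (q * x) = fun n => wienerDiag q x (n + 1) := by
  ext n
  simp only [wienerDiag]
  ring

/-- Both sides equal `t (1-q) [n+1]_q [n+2]_q`, by `1 - q^m = (1-q)[m]_q`. -/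
theorem wienerOffDiag_sq_mul (q t : ℝ) :
    wienerOffDiag q (q ^ 2 * t) t = fun n => wienerOffDiag q t t (n + 1) := by
  ext n
  have h1 := qNum_mul_one_sub q (n + 1)
  have h2 := qNum_mul_one_sub q (n + 2)
  simp only [wienerOffDiag]
  rw [show t - q ^ 2 * t * q ^ n = t * (1 - q ^ (n + 2)) by ring,
    show t - t * q ^ (n + 1) = t * (1 - q ^ (n + 1)) by ring, ← h1, ← h2]
  ring

theorem polyW_eq_polyQ (q x t : ℝ) :
    polyW 0 0 q x t = polyQ 0 0 q (q * x) (q ^ 2 * t) t := by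
  ext1 n
  induction n using Nat.twoStepInduction with
  | zero => rfl
  | one => simp [polyW, polyQ, mul_comm]
  | more n h0 h1 =>
    have hd : x * q ^ (n + 2) = q * x * q ^ (n + 1) := by ring
    have hb : (1 - q) * t * qNum q (n + 1) * qNum q (n + 2)
        = (t - q ^ 2 * t * q ^ n) * qNum q (n + 1) := by
      linear_combination t * qNum q (n + 1) * qNum_mul_one_sub q (n + 2)
    simp [-map_mul, -map_sub, polyW, polyQ, h0, h1, hd, hb]

section Bounds

variable {q : ℝ}

theorem abs_pow_le_one (hq₀ : -1 < q) (hq₁ : q < 1) (n : ℕ) : |q ^ n| ≤ 1 := by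
  rw [abs_pow]
  exact pow_le_one₀ (abs_nonneg q) (abs_lt.2 ⟨hq₀, hq₁⟩).le

theorem qNum_nonneg (hq₀ : -1 < q) (hq₁ : q < 1) (n : ℕ) : 0 ≤ qNum q n := by
  refine nonneg_of_mul_nonneg_left ?_ (sub_pos.2 hq₁)
  rw [qNum_mul_one_sub]
  linarith [(abs_le.1 (abs_pow_le_one hq₀ hq₁ n)).2]

theorem qNum_le (hq₀ : -1 < q) (hq₁ : q < 1) (n : ℕ) : qNum q n ≤ 2 / (1 - q) := by
  rw [le_div_iff₀ (sub_pos.2 hq₁), qNum_mul_one_sub]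
  linarith [(abs_le.1 (abs_pow_le_one hq₀ hq₁ n)).1]

theorem abs_wienerDiag_le (hq₀ : -1 < q) (hq₁ : q < 1) (x : ℝ) (n : ℕ) :
    |wienerDiag q x n| ≤ |x| := by
  rw [wienerDiag, abs_mul]
  exact mul_le_of_le_one_right (abs_nonneg x) (abs_pow_le_one hq₀ hq₁ n)

theorem wienerOffDiag_nonneg (hq₀ : -1 < q) (hq₁ : q < 1) {s t : ℝ} (hs : 0 ≤ s) (hst : s ≤ t)
    (n : ℕ) : 0 ≤ wienerOffDiag q s t n := by
  refine mul_nonneg ?_ (qNum_nonneg hq₀ hq₁ _)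
  nlinarith [(abs_le.1 (abs_pow_le_one hq₀ hq₁ n)).2]

theorem abs_wienerOffDiag_le (hq₀ : -1 < q) (hq₁ : q < 1) {s t M : ℝ} (hs : 0 ≤ s) (hst : s ≤ t)
    (htM : t ≤ M) (n : ℕ) : |wienerOffDiag q s t n| ≤ 2 * M * (2 / (1 - q)) := by
  rw [abs_of_nonneg (wienerOffDiag_nonneg hq₀ hq₁ hs hst n), wienerOffDiag]
  refine mul_le_mul ?_ (qNum_le hq₀ hq₁ _) (qNum_nonneg hq₀ hq₁ _) (by linarith)
  nlinarith [(abs_le.1 (abs_pow_le_one hq₀ hq₁ n)).1]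

theorem existsUnique_isOrthogonalityMeasure_polyQ (hq₀ : -1 < q) (hq₁ : q < 1) {s t : ℝ}
    (hs : 0 ≤ s) (hst : s < t) (x : ℝ) :
    ∃! μ : Measure ℝ, IsOrthogonalityMeasure (polyQ 0 0 q x s t) μ := by
  rw [polyQ_eq_favardPoly]
  have ha := abs_wienerDiag_le hq₀ hq₁ x
  have hb := abs_wienerOffDiag_le hq₀ hq₁ hs hst.le le_rfl
  obtain ⟨μ, hμ⟩ := exists_isOrthogonalityMeasure_favardPoly ha
    (wienerOffDiag_nonneg hq₀ hq₁ hs hst.le)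
    fun n => Real.sqrt_le_sqrt ((le_abs_self _).trans (hb n))
  exact ⟨μ, hμ, fun ν hν => hν.eq_of_bounded hμ ha hb⟩

theorem isOrthogonalityMeasure_wienerTransition (hq₀ : -1 < q) (hq₁ : q < 1) {s t : ℝ}
    (hs : 0 ≤ s) (hst : s < t) (x : ℝ) :
    IsOrthogonalityMeasure (polyQ 0 0 q x s t) (wienerTransition q s t x) := by
  have h := (existsUnique_isOrthogonalityMeasure_polyQ hq₀ hq₁ hs hst x).exists
  rw [wienerTransition, transitionMeasure, orthogonalityMeasure, dif_pos h]
  exact h.choose_spec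

/-! ### Difference quotients and generators -/

/-- The difference quotient over `[s, t]` is an integral of the second-order Taylor remainder
against a probability measure. -/
theorem quotient_eq_integral (hq₀ : -1 < q) (hq₁ : q < 1) {s t : ℝ} (hs : 0 ≤ s) (hst : s < t)
    {f : ℝ → ℝ} (hf : ContDiff ℝ 2 f) (x : ℝ) :
    1 / (t - s) * (transitionOp (wienerTransition q) s t f x - f x)
      = ∫ y, derivDividedDifference f x y
          ∂squareTilt (wienerDiag q x) (wienerOffDiag q s t) (wienerTransition q s t x) := by
  have hμ := isOrthogonalityMeasure_wienerTransition hq₀ hq₁ hs hst x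
  rw [polyQ_eq_favardPoly] at hμ
  have h := hμ.integral_sub_eq (by rw [wienerOffDiag_zero]; exact sub_pos.2 hst)
    (abs_wienerDiag_le hq₀ hq₁ x) (abs_wienerOffDiag_le hq₀ hq₁ hs hst.le le_rfl) hf
  have h0 : wienerDiag q x 0 = x := by simp [wienerDiag]
  rw [h0, wienerOffDiag_zero] at h
  exact h

theorem abs_quotient_le (hq₀ : -1 < q) (hq₁ : q < 1) {s t : ℝ} (hs : 0 ≤ s) (hst : s < t)
    {f : ℝ → ℝ} (hf : ContDiff ℝ 2 f) {K : ℝ} (hK : ∀ x, |deriv (deriv f) x| ≤ K) (x : ℝ) :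
    |1 / (t - s) * (transitionOp (wienerTransition q) s t f x - f x)| ≤ K := by
  have hμ := isOrthogonalityMeasure_wienerTransition hq₀ hq₁ hs hst x
  rw [polyQ_eq_favardPoly] at hμ
  have := hμ.isProbabilityMeasure_squareTilt (by rw [wienerOffDiag_zero]; exact sub_pos.2 hst)
  rw [quotient_eq_integral hq₀ hq₁ hs hst hf]
  simpa using norm_integral_le_of_norm_le_const
    (μ := squareTilt (wienerDiag q x) (wienerOffDiag q s t) (wienerTransition q s t x))
    (f := derivDividedDifference f x) (ae_of_all _ (abs_derivDividedDifference_le hf hK x))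

theorem sq_mul_lt (hq₀ : -1 < q) (hq₁ : q < 1) {t : ℝ} (ht : 0 < t) : q ^ 2 * t < t := by
  have : q ^ 2 < 1 := by nlinarith
  nlinarith

/-- Both endpoints may move, so the left and the right generator are instances of one limit. -/
theorem tendsto_quotient (hq₀ : -1 < q) (hq₁ : q < 1) {t : ℝ} (ht : 0 < t) {ι : Type*}
    {l : Filter ι} {σ τ : ι → ℝ} (hσ : Tendsto σ l (𝓝 t)) (hτ : Tendsto τ l (𝓝 t))
    (hστ : ∀ᶠ i in l, σ i < τ i) {f : ℝ → ℝ} (hf : ContDiff ℝ 2 f) (x : ℝ) :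
    Tendsto (fun i => 1 / (τ i - σ i)
        * (transitionOp (wienerTransition q) (σ i) (τ i) f x - f x)) l
      (𝓝 (wienerGenerator q t f x)) := by
  have hσ0 : ∀ᶠ i in l, 0 < σ i := hσ.eventually_const_lt ht
  have hτM : ∀ᶠ i in l, τ i < t + 1 := hτ.eventually_lt_const (lt_add_one t)
  have hν := isOrthogonalityMeasure_wienerTransition hq₀ hq₁ (mul_nonneg (sq_nonneg q) ht.le)
    (sq_mul_lt hq₀ hq₁ ht) (q * x)
  rw [polyQ_eq_favardPoly, wienerDiag_mul, wienerOffDiag_sq_mul] at hν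
  -- At `s = t` the coefficient `b 0` vanishes, so the shift applies. The constant `B` uses the
  -- eventual bound `τ i < t + 1`.
  have key := tendsto_integral_squareTilt (l := l) (a := fun _ => wienerDiag q x)
    (b := fun i => wienerOffDiag q (σ i) (τ i)) (a' := wienerDiag q x)
    (b' := wienerOffDiag q t t) (μ := fun i => wienerTransition q (σ i) (τ i) x)
    (A := |x|) (B := 2 * (t + 1) * (2 / (1 - q))) ?_ hν ?_ (by simp [wienerOffDiag_zero])
    (Eventually.of_forall fun _ => abs_wienerDiag_le hq₀ hq₁ x) ?_
    (abs_wienerDiag_le hq₀ hq₁ x)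
    (abs_wienerOffDiag_le hq₀ hq₁ ht.le le_rfl (lt_add_one t).le)
    (fun _ => tendsto_const_nhds)
    (fun n => (hτ.sub (hσ.mul_const _)).mul_const _)
    (continuous_derivDividedDifference hf x)
  · refine key.congr' ?_
    filter_upwards [hσ0, hστ] with i h1 h2
    exact (quotient_eq_integral hq₀ hq₁ h1.le h2 hf x).symm
  · filter_upwards [hσ0, hστ] with i h1 h2
    rw [← polyQ_eq_favardPoly]
    exact isOrthogonalityMeasure_wienerTransition hq₀ hq₁ h1.le h2 x
  · filter_upwards [hστ] with i h2
    rw [wienerOffDiag_zero]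
    exact sub_pos.2 h2
  · filter_upwards [hσ0, hστ, hτM] with i h1 h2 h3
    exact abs_wienerOffDiag_le hq₀ hq₁ h1.le h2.le h3.le

theorem isPointwiseLeftGenerator_wiener (hq₀ : -1 < q) (hq₁ : q < 1) {t : ℝ} (ht : 0 < t)
    {f : ℝ → ℝ} (hf : ContDiff ℝ 2 f) :
    IsPointwiseLeftGenerator (wienerTransition q) t f (wienerGenerator q t f) := by
  intro x
  have h0 : Tendsto (fun h : ℝ => t - h) (𝓝[>] 0) (𝓝 t) :=
    (Continuous.tendsto' (by fun_prop) _ _ (sub_zero t)).mono_left nhdsWithin_le_nhds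
  have h := tendsto_quotient hq₀ hq₁ ht h0 tendsto_const_nhds
    (by filter_upwards [self_mem_nhdsWithin] with h hh using sub_lt_self t hh) hf x
  simpa only [leftQuotient, sub_sub_cancel] using h

theorem isPointwiseRightGenerator_wiener (hq₀ : -1 < q) (hq₁ : q < 1) {t : ℝ} (ht : 0 < t)
    {f : ℝ → ℝ} (hf : ContDiff ℝ 2 f) :
    IsPointwiseRightGenerator (wienerTransition q) t f (wienerGenerator q t f) := by
  intro x
  have h0 : Tendsto (fun h : ℝ => t + h) (𝓝[>] 0) (𝓝 t) :=
    (Continuous.tendsto' (by fun_prop) _ _ (add_zero t)).mono_left nhdsWithin_le_nhds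
  have h := tendsto_quotient hq₀ hq₁ ht tendsto_const_nhds h0
    (by filter_upwards [self_mem_nhdsWithin] with h hh using lt_add_of_pos_right t hh) hf x
  simpa only [rightQuotient, add_sub_cancel_left] using h

theorem integrable_derivDividedDifference (hq₀ : -1 < q) (hq₁ : q < 1) {t : ℝ} (ht : 0 < t)
    {f : ℝ → ℝ} (hf : ContDiff ℝ 2 f) (x : ℝ) :
    Integrable (derivDividedDifference f x) (wienerTransition q (q ^ 2 * t) t (q * x)) := by
  have hs := mul_nonneg (sq_nonneg q) ht.le
  have hst := sq_mul_lt hq₀ hq₁ ht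
  have hν := isOrthogonalityMeasure_wienerTransition hq₀ hq₁ hs hst (q * x)
  have := hν.isProbabilityMeasure
  rw [polyQ_eq_favardPoly] at hν
  exact integrable_of_ae_abs_le (hν.ae_abs_le (abs_wienerDiag_le hq₀ hq₁ _)
    (abs_wienerOffDiag_le hq₀ hq₁ hs hst.le le_rfl)) (continuous_derivDividedDifference hf x)

end Bounds

end QMeixner

end

theorem mainTheorem3 (q : ℝ) (hq₀ : -1 < q) (hq₁ : q < 1) :
    -- the transition probabilities are well defined
    (∀ s t x : ℝ, 0 ≤ s → s < t →
      (∃! μ : Measure ℝ, QMeixner.IsOrthogonalityMeasure (QMeixner.polyQ 0 0 q x s t) μ) ∧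
      QMeixner.IsOrthogonalityMeasure (QMeixner.polyQ 0 0 q x s t)
        (QMeixner.wienerTransition q s t x)) ∧
    ∀ t : ℝ, 0 < t →
      (∀ x : ℝ, QMeixner.IsOrthogonalityMeasure (QMeixner.polyW 0 0 q x t)
          (QMeixner.nuMeasure 0 0 q x t) ∧
        QMeixner.nuMeasure 0 0 q x t = QMeixner.wienerTransition q (q ^ 2 * t) t (q * x)) ∧
      -- action on polynomials
      (∀ p : ℝ[X],
        (∀ x : ℝ, Integrable (QMeixner.derivDividedDifference (fun y => p.eval y) x)
          (QMeixner.wienerTransition q (q ^ 2 * t) t (q * x))) ∧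
        QMeixner.IsPointwiseLeftGenerator (QMeixner.wienerTransition q) t
          (fun y => p.eval y) (QMeixner.wienerGenerator q t (fun y => p.eval y)) ∧
        QMeixner.IsPointwiseRightGenerator (QMeixner.wienerTransition q) t
          (fun y => p.eval y) (QMeixner.wienerGenerator q t (fun y => p.eval y))) ∧
      -- action on bounded functions of class C² with bounded second derivative
      (∀ f : ℝ → ℝ, ContDiff ℝ 2 f → (∃ K, ∀ x, |f x| ≤ K) →
        (∃ K, ∀ x, |deriv (deriv f) x| ≤ K) →
        (∀ x : ℝ, Integrable (QMeixner.derivDividedDifference f x)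
          (QMeixner.wienerTransition q (q ^ 2 * t) t (q * x))) ∧
        QMeixner.IsWeakLeftGenerator (QMeixner.wienerTransition q) t f
          (QMeixner.wienerGenerator q t f) ∧
        QMeixner.IsWeakRightGenerator (QMeixner.wienerTransition q) t f
          (QMeixner.wienerGenerator q t f)) := by
  refine ⟨fun s t x hs hst =>
    ⟨QMeixner.existsUnique_isOrthogonalityMeasure_polyQ hq₀ hq₁ hs hst x,
      QMeixner.isOrthogonalityMeasure_wienerTransition hq₀ hq₁ hs hst x⟩,
    fun t ht => ⟨fun x => ?_, fun p => ?_, fun f hf hb hd => ?_⟩⟩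
  · have heq : QMeixner.nuMeasure 0 0 q x t
        = QMeixner.wienerTransition q (q ^ 2 * t) t (q * x) := by
      rw [QMeixner.nuMeasure, QMeixner.polyW_eq_polyQ]
      -- Once the polynomial sequences coincide, both measures are the same choice.
      rfl
    refine ⟨?_, heq⟩
    rw [heq, QMeixner.polyW_eq_polyQ]
    exact QMeixner.isOrthogonalityMeasure_wienerTransition hq₀ hq₁
      (mul_nonneg (sq_nonneg q) ht.le) (QMeixner.sq_mul_lt hq₀ hq₁ ht) (q * x)
  · have hp : ContDiff ℝ 2 fun y => p.eval y := by
      simpa using p.contDiff_aeval (𝕜 := ℝ) 2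
    exact ⟨QMeixner.integrable_derivDividedDifference hq₀ hq₁ ht hp,
      QMeixner.isPointwiseLeftGenerator_wiener hq₀ hq₁ ht hp,
      QMeixner.isPointwiseRightGenerator_wiener hq₀ hq₁ ht hp⟩
  · obtain ⟨K, hK⟩ := hd
    refine ⟨QMeixner.integrable_derivDividedDifference hq₀ hq₁ ht hf,
      ⟨hf.continuous, hb, QMeixner.isPointwiseLeftGenerator_wiener hq₀ hq₁ ht hf,
        K, fun h h0 hht x => ?_⟩,
      ⟨hf.continuous, hb, QMeixner.isPointwiseRightGenerator_wiener hq₀ hq₁ ht hf,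
        K, fun h h0 x => ?_⟩⟩
    · simpa only [QMeixner.leftQuotient, sub_sub_cancel] using
        QMeixner.abs_quotient_le hq₀ hq₁ (sub_nonneg.2 hht) (sub_lt_self t h0) hf hK x
    · simpa only [QMeixner.rightQuotient, add_sub_cancel_left] using
        QMeixner.abs_quotient_le hq₀ hq₁ ht.le (lt_add_of_pos_right t h0) hf hK x
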